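/- Let $A$ be a complex abelian variety of dimension $n$, let $\varphi : A \to A$ be an isogeny (a surjective holomorphic homomorphism with finite kernel), and let $\Gamma = \{\gamma_1,\dots,\gamma_n\}$ be the multiset of eigenvalues, counted with algebraic multiplicity, of the pullback $\varphi^*$ on the space $H^{1,0}(A)$ of global holomorphic $1$-forms on $A$. Let $B \subseteq A$ be an abelian subvariety of dimension $m$ (a closed connected complex-analytic subgroup) satisfying $\varphi(B) = B$, and let $\Delta = \{\delta_1,\dots,\delta_m\}$ be the multiset of eigenvalues of $(\varphi|_B)^*$ on $H^{1,0}(B)$. Let $\varphi_B : A/B \to A/B$ be the endomorphism induced by $\varphi$ on the quotient abelian variety. Then $\Delta$ is a submultiset of $\Gamma$, and the multiset of eigenvalues of $\varphi_B^*$ on $H^{1,0}(A/B)$ is the difference multiset $\Gamma - \Delta$. (In particular, these spaces of $1$-forms are finite-dimensional, with $\dim H^{1,0}(A) = n$ and $\dim H^{1,0}(B) = m$.) -/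

import Mathlib

open scoped Manifold ContDiff Topology

noncomputable section

namespace ComplexAV

section Forms

variable (E : Type*) [NormedAddCommGroup E] [NormedSpace ℂ E]
  (M : Type*) [TopologicalSpace M] [ChartedSpace E M] [IsManifold 𝓘(ℂ, E) ω M]

/-- `H^{1,0}(M)` for a complex manifold `M` modelled on `E`: the complex vector space of global
holomorphic `1`-forms, i.e. of global holomorphic sections of the holomorphic cotangent bundle
(regularity `ω` over `ℂ` means complex analytic). -/
abbrev H10 : Type _ :=
  Cₛ^ω⟮𝓘(ℂ, E); E →L[ℂ] ℂ, fun x : M ↦ TangentSpace 𝓘(ℂ, E) x →L[ℂ] Bundle.Trivial M ℂ x⟯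

variable {E M}
variable {E' : Type*} [NormedAddCommGroup E'] [NormedSpace ℂ E']
  {M' : Type*} [TopologicalSpace M'] [ChartedSpace E' M'] [IsManifold 𝓘(ℂ, E') ω M']

theorem contMDiff_pullback {f : M → M'} (hf : ContMDiff 𝓘(ℂ, E) 𝓘(ℂ, E') ω f) (η : H10 E' M') :
    ContMDiff 𝓘(ℂ, E) (𝓘(ℂ, E).prod 𝓘(ℂ, E →L[ℂ] ℂ)) ω
      (fun x ↦ Bundle.TotalSpace.mk' (E →L[ℂ] ℂ)
        (E := fun x : M ↦ TangentSpace 𝓘(ℂ, E) x →L[ℂ] Bundle.Trivial M ℂ x) x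
        ((η (f x)).comp (mfderiv 𝓘(ℂ, E) 𝓘(ℂ, E') f x))) := by
  intro x₀
  rw [contMDiffAt_hom_bundle]
  refine ⟨contMDiffAt_id, ?_⟩
  have h1 := (contMDiffAt_hom_bundle _).1 (η.contMDiff (f x₀))
  have h2 := (h1.2.comp x₀ (hf x₀))
  have h3 := (hf x₀).mfderiv_const (m := ω) le_rfl
  refine (h2.clm_comp h3).congr_of_eventuallyEq ?_
  have hc : ∀ᶠ x in 𝓝 x₀, f x ∈ (trivializationAt E' (TangentSpace 𝓘(ℂ, E')) (f x₀)).baseSet :=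
    (hf x₀).continuousAt.eventually_mem
      ((trivializationAt E' (TangentSpace 𝓘(ℂ, E')) (f x₀)).open_baseSet.mem_nhds
        (FiberBundle.mem_baseSet_trivializationAt' (f x₀)))
  filter_upwards [hc] with x hx
  ext v
  simp only [inTangentCoordinates, ContinuousLinearMap.inCoordinates, Function.comp_apply, id_eq,
    ContinuousLinearMap.comp_apply]
  rw [Bundle.Trivialization.symmL_continuousLinearMapAt _ hx]
  simp

/-- The pullback `f^* : H^{1,0}(M') → H^{1,0}(M)` of holomorphic `1`-forms along a holomorphic map
`f : M → M'`, given by `(f^* η)_x = η_{f x} ∘ df_x`. -/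
def pullback (f : M → M') (hf : ContMDiff 𝓘(ℂ, E) 𝓘(ℂ, E') ω f) : H10 E' M' →ₗ[ℂ] H10 E M where
  toFun η := ⟨fun x ↦ (η (f x)).comp (mfderiv 𝓘(ℂ, E) 𝓘(ℂ, E') f x), contMDiff_pullback hf η⟩
  map_add' η θ := by
    ext x : 1
    exact ContinuousLinearMap.add_comp (η (f x)) (θ (f x)) (mfderiv 𝓘(ℂ, E) 𝓘(ℂ, E') f x)
  map_smul' c η := by
    ext x : 1
    exact ContinuousLinearMap.smul_comp c (η (f x)) (mfderiv 𝓘(ℂ, E) 𝓘(ℂ, E') f x)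

end Forms

/-- The multiset of eigenvalues, with algebraic multiplicities, of an endomorphism of a
finite-dimensional complex vector space. -/
def eigenvalues {V : Type*} [AddCommGroup V] [Module ℂ V] [FiniteDimensional ℂ V]
    (T : V →ₗ[ℂ] V) : Multiset ℂ :=
  T.charpoly.roots

section Varieties

variable (E : Type*) [NormedAddCommGroup E] [NormedSpace ℂ E]
  {A : Type*} [AddCommGroup A] [TopologicalSpace A] [ChartedSpace E A]

/-- `f : A → ℙ^N(ℂ)` is an injective holomorphic immersion. Near each point `f` is given by
homogeneous coordinates `x ↦ [F₀(x) : ⋯ : F_N(x)]` with `F` holomorphic and nowhere zero; the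
differential of `f` at `x` is the differential of `F` at `x` modulo the line `ℂ F(x)`. -/
def IsProjectiveEmbedding {N : ℕ} (f : A → Projectivization ℂ (Fin (N + 1) → ℂ)) : Prop :=
  Function.Injective f ∧
  ∀ x : A, ∃ F : A → (Fin (N + 1) → ℂ),
    ContMDiffAt 𝓘(ℂ, E) 𝓘(ℂ, Fin (N + 1) → ℂ) ω F x ∧
    (∀ᶠ y in 𝓝 x, ∃ hy : F y ≠ 0, f y = Projectivization.mk ℂ (F y) hy) ∧
    ∀ v : TangentSpace 𝓘(ℂ, E) x,
      mfderiv 𝓘(ℂ, E) 𝓘(ℂ, Fin (N + 1) → ℂ) F x v ∈ Submodule.span ℂ {F x} → v = 0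

variable (A) in
/-- A complex abelian variety: a compact connected complex Lie group, written additively, which
is projective. -/
structure IsAbelianVariety [LieAddGroup 𝓘(ℂ, E) ω A] : Prop where
  t2Space : T2Space A
  compactSpace : CompactSpace A
  connectedSpace : ConnectedSpace A
  projective : ∃ (N : ℕ) (f : A → Projectivization ℂ (Fin (N + 1) → ℂ)), IsProjectiveEmbedding E f

/-- An isogeny `A → A`: a holomorphic group homomorphism which is surjective with finite kernel. -/
structure IsIsogeny (φ : A →+ A) : Prop where
  holomorphic : ContMDiff 𝓘(ℂ, E) 𝓘(ℂ, E) ω φ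
  surjective : Function.Surjective φ
  finite_ker : Finite φ.ker

/-- An abelian subvariety of `A`: a closed connected subgroup which is a complex submanifold, its
complex structure being the one for which the inclusion is a holomorphic embedding. -/
structure IsAbelianSubvariety (F : Type*) [NormedAddCommGroup F] [NormedSpace ℂ F]
    (B : AddSubgroup A) [ChartedSpace F B] [IsManifold 𝓘(ℂ, F) ω B] : Prop where
  isClosed : IsClosed (B : Set A)
  isConnected : IsConnected (B : Set A)
  embedding : Manifold.IsSmoothEmbedding 𝓘(ℂ, F) 𝓘(ℂ, E) ω (Subtype.val : B → A)

/-- The given complex structure on the group `A ⧸ B` is the quotient complex structure: the one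
for which the projection `A → A ⧸ B` is a holomorphic submersion. -/
structure IsQuotientVariety (G : Type*) [NormedAddCommGroup G] [NormedSpace ℂ G]
    (B : AddSubgroup A) [ChartedSpace G (A ⧸ B)] [IsManifold 𝓘(ℂ, G) ω (A ⧸ B)] : Prop where
  submersion : Manifold.IsSubmersion 𝓘(ℂ, E) 𝓘(ℂ, G) ω (QuotientAddGroup.mk : A → A ⧸ B)

end Varieties

section Induced

variable {A : Type*} [AddCommGroup A]

/-- The restriction `B → B` of an endomorphism `φ` of `A` with `φ(B) = B`. -/
def restrict (φ : A →+ A) (B : AddSubgroup A) (h : B.map φ = B) : B →+ B :=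
  (φ.comp B.subtype).codRestrict B fun b ↦ h.le (AddSubgroup.mem_map_of_mem φ b.2)

/-- The endomorphism `φ_B` of `A ⧸ B` induced by an endomorphism `φ` of `A` with `φ(B) = B`. -/
def descend (φ : A →+ A) (B : AddSubgroup A) (h : B.map φ = B) : A ⧸ B →+ A ⧸ B :=
  QuotientAddGroup.map B B φ (AddSubgroup.map_le_iff_le_comap.1 h.le)

variable {E : Type*} [NormedAddCommGroup E] [NormedSpace ℂ E]
  [TopologicalSpace A] [ChartedSpace E A]

theorem IsAbelianSubvariety.contMDiff_restrict {F : Type*} [NormedAddCommGroup F]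
    [NormedSpace ℂ F] {B : AddSubgroup A} [ChartedSpace F B] [IsManifold 𝓘(ℂ, F) ω B]
    (hB : IsAbelianSubvariety E F B)
    {φ : A →+ A} (hφ : ContMDiff 𝓘(ℂ, E) 𝓘(ℂ, E) ω φ) (h : B.map φ = B) :
    ContMDiff 𝓘(ℂ, F) 𝓘(ℂ, F) ω (restrict φ B h) := by
  rw [ContMDiff.iff_comp_isImmersion hB.embedding.isImmersion]
  have hc : ContMDiff 𝓘(ℂ, F) 𝓘(ℂ, E) ω (fun b : B ↦ φ b) :=
    hφ.comp hB.embedding.isImmersion.contMDiff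
  exact ⟨hc.continuous.subtype_mk _, hc⟩

theorem IsQuotientVariety.contMDiff_descend {G : Type*} [NormedAddCommGroup G]
    [NormedSpace ℂ G] {B : AddSubgroup A} [ChartedSpace G (A ⧸ B)]
    [IsManifold 𝓘(ℂ, G) ω (A ⧸ B)] (hQ : IsQuotientVariety E G B)
    {φ : A →+ A} (hφ : ContMDiff 𝓘(ℂ, E) 𝓘(ℂ, E) ω φ) (h : B.map φ = B) :
    ContMDiff 𝓘(ℂ, G) 𝓘(ℂ, G) ω (descend φ B h) := by
  intro y
  obtain ⟨a, rfl⟩ := QuotientAddGroup.mk_surjective y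
  have hs := hQ.submersion.isSubmersionAt a
  let u : A ⧸ B → E := fun z ↦ hs.equiv.symm (hs.codChart z, (hs.equiv (hs.domChart a)).2)
  have hw : ∀ e ∈ hs.domChart.target,
      hs.codChart (QuotientAddGroup.mk (hs.domChart.symm e) : A ⧸ B) = (hs.equiv e).1 := by
    intro e he
    have he' : e ∈ (hs.domChart.extend 𝓘(ℂ, E)).target := by simpa using he
    simpa using hs.writtenInCharts he'
  have ha := hs.mem_domChart_source
  have hua : u (a : A ⧸ B) = hs.domChart a := by
    have := hw _ (hs.domChart.map_source ha)
    rw [hs.domChart.left_inv ha] at this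
    simp only [u, this, Prod.mk.eta, ContinuousLinearEquiv.symm_apply_apply]
  have hu : ContMDiffAt 𝓘(ℂ, G) 𝓘(ℂ, E) ω u (a : A ⧸ B) := by
    have h1 : ContMDiffAt 𝓘(ℂ, G) 𝓘(ℂ, G) ω hs.codChart (a : A ⧸ B) :=
      contMDiffAt_of_mem_maximalAtlas hs.codChart_mem_maximalAtlas hs.mem_codChart_source
    have h2 : ContDiff ℂ ω
        (fun g : G ↦ hs.equiv.symm (g, (hs.equiv (hs.domChart a)).2)) := by fun_prop
    exact h2.contMDiff.contMDiffAt.comp _ h1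
  have hta : hs.domChart a ∈ hs.domChart.target := hs.domChart.map_source ha
  have hσ : ContMDiffAt 𝓘(ℂ, G) 𝓘(ℂ, E) ω (fun z ↦ hs.domChart.symm (u z)) (a : A ⧸ B) := by
    have h1 : ContMDiffAt 𝓘(ℂ, E) 𝓘(ℂ, E) ω hs.domChart.symm (u (a : A ⧸ B)) := by
      rw [hua]
      exact contMDiffAt_symm_of_mem_maximalAtlas hs.domChart_mem_maximalAtlas hta
    exact h1.comp _ hu
  have hq : ContMDiff 𝓘(ℂ, E) 𝓘(ℂ, G) ω (QuotientAddGroup.mk : A → A ⧸ B) :=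
    hQ.submersion.contMDiff
  have hφq : ContMDiff 𝓘(ℂ, E) 𝓘(ℂ, G) ω (fun x ↦ (QuotientAddGroup.mk (φ x) : A ⧸ B)) :=
    hq.comp hφ
  refine (hφq.contMDiffAt.comp _ hσ).congr_of_eventuallyEq ?_
  have e1 : ∀ᶠ z in 𝓝 (a : A ⧸ B), u z ∈ hs.domChart.target :=
    hu.continuousAt.eventually_mem (hs.domChart.open_target.mem_nhds (hua ▸ hta))
  have e2 : ∀ᶠ z in 𝓝 (a : A ⧸ B), z ∈ hs.codChart.source :=
    hs.codChart.open_source.mem_nhds hs.mem_codChart_source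
  filter_upwards [e1, e2] with z hz1 hz2
  have h1 := hw _ hz1
  have h2 : (QuotientAddGroup.mk (hs.domChart.symm (u z)) : A ⧸ B) = z := by
    refine hs.codChart.injOn (hs.source_subset_preimage_source (hs.domChart.map_target hz1)) hz2 ?_
    rw [h1]
    simp [u]
  conv_lhs => rw [← h2]
  rfl

end Induced

end ComplexAV

end

/-! On a compact connected complex Lie group `M`, translating a holomorphic 1-form back to the
tangent space at `0` gives a holomorphic map from `M` to a fixed vector space, hence a constant one.
So every form is invariant, and evaluation at `0` identifies `H10 E M` with the dual of the tangent
space (`evalZero`). For a holomorphic `f` fixing `0`, the pullback becomes the transpose of the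
differential of `f` at `0`, which has the same characteristic polynomial (`charpoly_pullback`).

Everything thus reduces to differentials at `0`. The tangent spaces of `B`, `A` and `A ⧸ B` form a
short exact sequence (`modelDeriv_exact`, with injectivity and surjectivity at the ends), compatible
with the differentials of the three endomorphisms. Characteristic polynomials multiply along it
(`LinearMap.charpoly_eq_mul_of_exact`), so the roots for `A` are the sum of the multisets of roots
for `B` and `A ⧸ B`. -/

/-! ### Linear algebra of characteristic polynomials. -/

theorem LinearMap.charpoly_dualMap {K V : Type*} [Field K] [AddCommGroup V] [Module K V]
    [FiniteDimensional K V] (T : V →ₗ[K] V) : T.dualMap.charpoly = T.charpoly := by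
  classical
  let b := Module.finBasis K V
  rw [← LinearMap.charpoly_toMatrix T b, ← LinearMap.charpoly_toMatrix T.dualMap b.dualBasis,
    ← Matrix.charpoly_transpose]
  congr 1
  rw [LinearMap.dualMap_def, LinearMap.toMatrix_transpose, Matrix.transpose_transpose]

/-- The characteristic polynomial is multiplicative in short exact sequences. -/
theorem LinearMap.charpoly_eq_mul_of_exact {K U V W : Type*} [Field K]
    [AddCommGroup U] [Module K U] [FiniteDimensional K U]
    [AddCommGroup V] [Module K V] [FiniteDimensional K V]
    [AddCommGroup W] [Module K W] [FiniteDimensional K W]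
    {i : U →ₗ[K] V} {q : V →ₗ[K] W} (hi : Function.Injective i) (hq : Function.Surjective q)
    (hex : Function.Exact i q) {R : U →ₗ[K] U} {S : V →ₗ[K] V} {T : W →ₗ[K] W}
    (hRS : S ∘ₗ i = i ∘ₗ R) (hST : q ∘ₗ S = T ∘ₗ q) :
    S.charpoly = R.charpoly * T.charpoly := by
  classical
  -- A linear section of `q` splits the sequence. In the resulting coordinates on `U × W`, `S` is
  -- block upper triangular with diagonal blocks `R` and `T`.
  obtain ⟨s, hs⟩ := q.exists_rightInverse_of_surjective (LinearMap.range_eq_top.2 hq)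
  have hqs (w : W) : q (s w) = w := LinearMap.congr_fun hs w
  have hqi (u : U) : q (i u) = 0 := hex.apply_apply_eq_zero u
  let e : (U × W) ≃ₗ[K] V := LinearEquiv.ofBijective (i.coprod s) (by
    constructor
    · rw [injective_iff_map_eq_zero]
      rintro ⟨u, w⟩ h
      have hw : w = 0 := by simpa [hqi, hqs] using congrArg q h
      subst hw
      have hu : i u = 0 := by simpa using h
      rw [(map_eq_zero_iff i hi).1 hu]
      rfl
    · intro v
      obtain ⟨u, hu⟩ := (hex (v - s (q v))).1 (by simp [hqs])
      exact ⟨(u, q v), by simp [hu]⟩)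
  have he (u : U) (w : W) : e (u, w) = i u + s w := rfl
  let bU := Module.finBasis K U
  let bW := Module.finBasis K W
  let b := bU.prod bW
  have hu (u : U) : e.symm.conj S (u, 0) = (R u, 0) := by
    rw [LinearEquiv.conj_apply_apply, LinearEquiv.symm_symm, LinearEquiv.symm_apply_eq, he, he]
    simpa using LinearMap.congr_fun hRS u
  have hw (w : W) : (e.symm (S (e (0, w)))).2 = T w := by
    have hp (v : V) : (e.symm v).2 = q v := by
      obtain ⟨⟨u, w⟩, rfl⟩ := e.surjective v
      rw [e.symm_apply_apply, he]
      simp [hqi, hqs]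
    rw [hp, he]
    simpa [hqs] using LinearMap.congr_fun hST (s w)
  -- The section need not commute with the endomorphisms, so the upper right block is arbitrary and
  -- is taken to be whatever the matrix contains.
  rw [← LinearEquiv.charpoly_conj e.symm S, ← LinearMap.charpoly_toMatrix _ b,
    ← LinearMap.charpoly_toMatrix R bU, ← LinearMap.charpoly_toMatrix T bW,
    ← Matrix.charpoly_fromBlocks_zero₂₁
      (M₁₂ := (LinearMap.toMatrix b b (e.symm.conj S)).toBlocks₁₂)]
  congr 1
  rw [← Matrix.fromBlocks_toBlocks (LinearMap.toMatrix b b (e.symm.conj S))]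
  simp only [Matrix.toBlocks_fromBlocks₁₂]
  congr 1
  · ext x y
    simp [Matrix.toBlocks₁₁, LinearMap.toMatrix_apply, b, hu]
  · ext x y
    simp [Matrix.toBlocks₂₁, LinearMap.toMatrix_apply, b, hu]
  · ext x y
    simp [Matrix.toBlocks₂₂, LinearMap.toMatrix_apply, b, hw]

namespace ComplexAV

/-! ### Differentials and tangent trivializations on model spaces. -/

section ModelDerivative

variable {E : Type*} [NormedAddCommGroup E] [NormedSpace ℂ E]
  {E₁ : Type*} [NormedAddCommGroup E₁] [NormedSpace ℂ E₁]
  {E₂ : Type*} [NormedAddCommGroup E₂] [NormedSpace ℂ E₂]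
  {M : Type*} [TopologicalSpace M] [ChartedSpace E M]
  {M₁ : Type*} [TopologicalSpace M₁] [ChartedSpace E₁ M₁]
  {M₂ : Type*} [TopologicalSpace M₂] [ChartedSpace E₂ M₂]

variable (E E₁) in
/-- The differential of a map of manifolds at `x`, as a map between the model spaces. -/
noncomputable def modelDeriv (f : M → M₁) (x : M) : E →L[ℂ] E₁ := mfderiv 𝓘(ℂ, E) 𝓘(ℂ, E₁) f x

/-- The base point `y` is kept separate from `f x` so that equalities such as `φ 0 = 0` can be
supplied without transporting between tangent spaces. -/
theorem modelDeriv_comp {g : M₁ → M₂} {f : M → M₁} {x : M} {y : M₁} (hy : f x = y)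
    (hg : MDifferentiableAt 𝓘(ℂ, E₁) 𝓘(ℂ, E₂) g y)
    (hf : MDifferentiableAt 𝓘(ℂ, E) 𝓘(ℂ, E₁) f x) :
    modelDeriv E E₂ (g ∘ f) x = (modelDeriv E₁ E₂ g y).comp (modelDeriv E E₁ f x) := by
  subst hy
  exact mfderiv_comp x hg hf

theorem modelDeriv_id (x : M) : modelDeriv E E (fun y : M ↦ y) x = ContinuousLinearMap.id ℂ E :=
  mfderiv_id

variable (E) in
/-- The trivialization of the tangent bundle at `x₀`, over the point `x`, as an endomorphism of the
model space. -/
noncomputable def tangentTriv (x₀ x : M) [IsManifold 𝓘(ℂ, E) ω M] : E →L[ℂ] E :=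
  (trivializationAt E (TangentSpace 𝓘(ℂ, E)) x₀).continuousLinearMapAt ℂ x

variable (E) in
/-- The inverse of `tangentTriv`. -/
noncomputable def tangentTrivSymm (x₀ x : M) [IsManifold 𝓘(ℂ, E) ω M] : E →L[ℂ] E :=
  (trivializationAt E (TangentSpace 𝓘(ℂ, E)) x₀).symmL ℂ x

theorem tangentTrivSymm_tangentTriv [IsManifold 𝓘(ℂ, E) ω M] (x₀ : M) :
    ∀ᶠ x in 𝓝 x₀, ∀ v, tangentTrivSymm E x₀ x (tangentTriv E x₀ x v) = v := by
  filter_upwards [(trivializationAt E (TangentSpace 𝓘(ℂ, E)) x₀).open_baseSet.mem_nhds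
    (FiberBundle.mem_baseSet_trivializationAt' x₀)] with x hx v
  exact Bundle.Trivialization.symmL_continuousLinearMapAt _ hx v

end ModelDerivative

/-! ### Holomorphic 1-forms on compact connected complex Lie groups. -/

section Forms

variable {E : Type*} [NormedAddCommGroup E] [NormedSpace ℂ E]
  {M : Type*} [TopologicalSpace M] [ChartedSpace E M]

/-- The value of a holomorphic `1`-form at a point, as a functional on the model space. -/
noncomputable def H10.at [IsManifold 𝓘(ℂ, E) ω M] (η : H10 E M) (x : M) : E →L[ℂ] ℂ := η x

/-- The target bundle is trivial, so reading a form in bundle coordinates only involves the inverse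
trivialization of the tangent bundle. -/
theorem contMDiffAt_form_iff [IsManifold 𝓘(ℂ, E) ω M] (η : M → E →L[ℂ] ℂ) (x₀ : M) :
    ContMDiffAt 𝓘(ℂ, E) (𝓘(ℂ, E).prod 𝓘(ℂ, E →L[ℂ] ℂ)) ω
      (fun x ↦ Bundle.TotalSpace.mk' (E →L[ℂ] ℂ)
        (E := fun x : M ↦ TangentSpace 𝓘(ℂ, E) x →L[ℂ] Bundle.Trivial M ℂ x) x (η x)) x₀ ↔
    ContMDiffAt 𝓘(ℂ, E) 𝓘(ℂ, E →L[ℂ] ℂ) ω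
      (fun x ↦ (η x).comp (tangentTrivSymm E x₀ x)) x₀ := by
  have : (fun x ↦ (η x).comp (tangentTrivSymm E x₀ x)) = (fun x ↦
      ContinuousLinearMap.inCoordinates E (TangentSpace 𝓘(ℂ, E)) ℂ (Bundle.Trivial M ℂ)
        x₀ x x₀ x (η x)) := by
    ext x v
    simp [ContinuousLinearMap.inCoordinates, tangentTrivSymm]
    rfl
  rw [this]
  exact (contMDiffAt_hom_bundle _).trans (and_iff_right contMDiffAt_id)

theorem H10.contMDiffAt_at [IsManifold 𝓘(ℂ, E) ω M] (η : H10 E M) (x₀ : M) :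
    ContMDiffAt 𝓘(ℂ, E) 𝓘(ℂ, E →L[ℂ] ℂ) ω (fun x ↦ (η.at x).comp (tangentTrivSymm E x₀ x)) x₀ :=
  (contMDiffAt_form_iff (fun x ↦ η.at x) x₀).1 (η.contMDiff x₀)

variable [AddCommGroup M] [LieAddGroup 𝓘(ℂ, E) ω M]

theorem mdifferentiable_const_add (x : M) :
    MDifferentiable 𝓘(ℂ, E) 𝓘(ℂ, E) (fun y : M ↦ x + y) :=
  (contMDiff_const.add contMDiff_id : ContMDiff _ _ ω _).mdifferentiable (by simp)

/-- The translate to `0` of a holomorphic `1`-form depends holomorphically on the base point. -/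
theorem H10.contMDiff_translate (η : H10 E M) :
    ContMDiff 𝓘(ℂ, E) 𝓘(ℂ, E →L[ℂ] ℂ) ω
      (fun x : M ↦ (η.at x).comp (modelDeriv E E (fun y : M ↦ x + y) 0)) := by
  intro x₀
  have h1 := η.contMDiffAt_at x₀
  -- Holomorphic dependence of the differential on the parameter is expressed in tangent
  -- trivializations at source and target. The factors from `h1` and `h3` cancel these near `x₀`.
  have h2 : ContMDiffAt 𝓘(ℂ, E) 𝓘(ℂ, E →L[ℂ] E) ω (fun x ↦ (tangentTriv E (x₀ + 0) (x + 0)).comp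
      ((modelDeriv E E (fun y : M ↦ x + y) 0).comp (tangentTrivSymm E (0 : M) 0))) x₀ :=
    ContMDiffAt.mfderiv (m := ω) (n := ω) (x₀ := x₀) (I := 𝓘(ℂ, E)) (I' := 𝓘(ℂ, E))
      (fun x y : M ↦ x + y) (fun _ ↦ 0)
      (contMDiff_add 𝓘(ℂ, E) ω).contMDiffAt contMDiffAt_const le_rfl
  have h3 : ContMDiffAt 𝓘(ℂ, E) 𝓘(ℂ, E →L[ℂ] E) ω
      (fun _ : M ↦ tangentTriv E (0 : M) 0) x₀ := contMDiffAt_const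
  refine ((h1.clm_comp h2).clm_comp h3).congr_of_eventuallyEq ?_
  filter_upwards [tangentTrivSymm_tangentTriv (E := E) x₀] with x hx
  have h0 := (tangentTrivSymm_tangentTriv (E := E) (0 : M)).self_of_nhds
  ext v
  simp only [ContinuousLinearMap.comp_apply, add_zero, h0, hx]

/-- Translating a functional on the tangent space at `0` gives a holomorphic `1`-form. -/
theorem contMDiff_invariantForm (ℓ : E →L[ℂ] ℂ) :
    ContMDiff 𝓘(ℂ, E) (𝓘(ℂ, E).prod 𝓘(ℂ, E →L[ℂ] ℂ)) ω
      (fun x ↦ Bundle.TotalSpace.mk' (E →L[ℂ] ℂ)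
        (E := fun x : M ↦ TangentSpace 𝓘(ℂ, E) x →L[ℂ] Bundle.Trivial M ℂ x) x
        (ℓ.comp (modelDeriv E E (fun y : M ↦ -x + y) x))) := by
  intro x₀
  refine (contMDiffAt_form_iff (fun x ↦ ℓ.comp (modelDeriv E E (fun y : M ↦ -x + y) x)) x₀).2 ?_
  have h2 : ContMDiffAt 𝓘(ℂ, E) 𝓘(ℂ, E →L[ℂ] E) ω (fun x ↦ (tangentTriv E (-x₀ + x₀) (-x + x)).comp
      ((modelDeriv E E (fun y : M ↦ -x + y) x).comp (tangentTrivSymm E x₀ x))) x₀ :=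
    ContMDiffAt.mfderiv (m := ω) (n := ω) (x₀ := x₀) (I := 𝓘(ℂ, E)) (I' := 𝓘(ℂ, E))
      (fun x y : M ↦ -x + y) (fun x ↦ x)
      (contMDiff_fst.neg.add contMDiff_snd).contMDiffAt contMDiffAt_id le_rfl
  have h3 : ContMDiffAt 𝓘(ℂ, E) 𝓘(ℂ, E →L[ℂ] ℂ) ω
      (fun _ : M ↦ ℓ.comp (tangentTrivSymm E (0 : M) 0)) x₀ := contMDiffAt_const
  refine (h3.clm_comp h2).congr_of_eventuallyEq (Filter.Eventually.of_forall fun x ↦ ?_)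
  have h0 := (tangentTrivSymm_tangentTriv (E := E) (0 : M)).self_of_nhds
  ext v
  simp only [ContinuousLinearMap.comp_apply, neg_add_cancel, h0]

variable (M) in
/-- The translation-invariant holomorphic `1`-form with value `ℓ` at `0`. -/
noncomputable def invariantForm (ℓ : E →L[ℂ] ℂ) : H10 E M :=
  ⟨fun x ↦ ℓ.comp (modelDeriv E E (fun y : M ↦ -x + y) x), contMDiff_invariantForm ℓ⟩

theorem invariantForm_at_zero (ℓ : E →L[ℂ] ℂ) : (invariantForm M ℓ).at 0 = ℓ := by
  change ℓ.comp (modelDeriv E E (fun y : M ↦ -0 + y) 0) = ℓ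
  simp only [neg_zero, zero_add, modelDeriv_id, ContinuousLinearMap.comp_id]

/-- A holomorphic `1`-form on a compact connected complex Lie group is determined by its value at
`0`. -/
theorem H10.eq_of_at_zero_eq [CompactSpace M] [PreconnectedSpace M] {η θ : H10 E M}
    (h : η.at 0 = θ.at 0) : η = θ := by
  -- The left side is a holomorphic function of `x` on a compact connected manifold, hence constant;
  -- its value at `x = 0` is `η.at 0`.
  have key (η : H10 E M) (x : M) :
      (η.at x).comp (modelDeriv E E (fun y : M ↦ x + y) 0) = η.at 0 := by
    have hd := η.contMDiff_translate.mdifferentiable (by simp)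
    have : IsManifold 𝓘(ℂ, E) 1 M := IsManifold.of_le (n := ω) (by simp)
    have := hd.apply_eq_of_compactSpace x 0
    rw [this]
    simp only [zero_add, modelDeriv_id, ContinuousLinearMap.comp_id]
  have inv (x : M) : (modelDeriv E E (fun y : M ↦ x + y) 0).comp
      (modelDeriv E E (fun y : M ↦ -x + y) x) = ContinuousLinearMap.id ℂ E := by
    rw [← modelDeriv_comp (neg_add_cancel x) (mdifferentiable_const_add x 0)
      (mdifferentiable_const_add (-x) x), ← modelDeriv_id x]
    congr 1
    ext y
    simp
  have hat (η : H10 E M) (x : M) :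
      η.at x = (η.at 0).comp (modelDeriv E E (fun y : M ↦ -x + y) x) := by
    rw [← key η x, ContinuousLinearMap.comp_assoc, inv, ContinuousLinearMap.comp_id]
  ext x : 1
  change η.at x = θ.at x
  rw [hat η, hat θ, h]

variable (E M) in
/-- On a compact connected complex Lie group, evaluation at `0` identifies the holomorphic
`1`-forms with the dual of the tangent space at `0`. -/
noncomputable def evalZero [CompactSpace M] [PreconnectedSpace M] [FiniteDimensional ℂ E] :
    H10 E M ≃ₗ[ℂ] Module.Dual ℂ E :=
  (LinearEquiv.ofBijective
    ({ toFun := fun η ↦ η.at 0, map_add' := fun _ _ ↦ rfl, map_smul' := fun _ _ ↦ rfl } :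
      H10 E M →ₗ[ℂ] (E →L[ℂ] ℂ))
    ⟨fun _ _ h ↦ H10.eq_of_at_zero_eq h, fun ℓ ↦ ⟨invariantForm M ℓ, invariantForm_at_zero ℓ⟩⟩).trans
    LinearMap.toContinuousLinearMap.symm

theorem evalZero_apply [CompactSpace M] [PreconnectedSpace M] [FiniteDimensional ℂ E]
    (η : H10 E M) : evalZero E M η = (η.at 0 : E →ₗ[ℂ] ℂ) := rfl

theorem finiteDimensional_H10 [CompactSpace M] [PreconnectedSpace M] [FiniteDimensional ℂ E] :
    FiniteDimensional ℂ (H10 E M) :=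
  (evalZero E M).symm.finiteDimensional

/-- Since `f 0 = 0`, the value of `f^* η` at `0` is `η.at 0` composed with the differential of `f`.
Hence `evalZero` conjugates the pullback to the transpose of that differential. -/
theorem charpoly_pullback [CompactSpace M] [PreconnectedSpace M] [FiniteDimensional ℂ E]
    [FiniteDimensional ℂ (H10 E M)]
    {f : M → M} (hf : ContMDiff 𝓘(ℂ, E) 𝓘(ℂ, E) ω f) (h0 : f 0 = 0) :
    (pullback f hf).charpoly = (modelDeriv E E f 0 : E →ₗ[ℂ] E).charpoly := by
  rw [← LinearMap.charpoly_dualMap (modelDeriv E E f 0 : E →ₗ[ℂ] E),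
    ← LinearEquiv.charpoly_conj (evalZero E M) (pullback f hf)]
  congr 1
  refine LinearMap.ext fun ℓ ↦ ?_
  obtain ⟨η, rfl⟩ := (evalZero E M).surjective ℓ
  rw [LinearEquiv.conj_apply_apply, LinearEquiv.symm_apply_apply, evalZero_apply, evalZero_apply]
  change (((η.at (f 0)).comp (modelDeriv E E f 0) : E →L[ℂ] ℂ) : E →ₗ[ℂ] ℂ) = _
  rw [h0]
  rfl

end Forms
-- The differential of a pointwise sum.
section DerivativeAtZero

variable {E : Type*} [NormedAddCommGroup E] [NormedSpace ℂ E]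
  {E₁ : Type*} [NormedAddCommGroup E₁] [NormedSpace ℂ E₁]
  {M : Type*} [TopologicalSpace M] [ChartedSpace E M]
  {M₁ : Type*} [TopologicalSpace M₁] [ChartedSpace E₁ M₁]

/-- Both partial maps of addition at `(0, 0)` are the identity, so the differential of addition
there is `(v, w) ↦ v + w`. -/
theorem modelDeriv_add [AddCommGroup M₁] [LieAddGroup 𝓘(ℂ, E₁) ω M₁] {f g : M → M₁} {x : M}
    (hf : MDifferentiableAt 𝓘(ℂ, E) 𝓘(ℂ, E₁) f x) (hg : MDifferentiableAt 𝓘(ℂ, E) 𝓘(ℂ, E₁) g x)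
    (hf0 : f x = 0) (hg0 : g x = 0) :
    modelDeriv E E₁ (fun y ↦ f y + g y) x = modelDeriv E E₁ f x + modelDeriv E E₁ g x := by
  have hadd : MDifferentiableAt (𝓘(ℂ, E₁).prod 𝓘(ℂ, E₁)) 𝓘(ℂ, E₁)
      (fun p : M₁ × M₁ ↦ p.1 + p.2) (f x, g x) :=
    ((contMDiff_add 𝓘(ℂ, E₁) ω).mdifferentiable (by simp)) _
  have h1 := mfderiv_comp x hadd (hf.prodMk hg)
  ext v
  have h2 : modelDeriv E E₁ (fun y ↦ f y + g y) x v =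
      mfderiv (𝓘(ℂ, E₁).prod 𝓘(ℂ, E₁)) 𝓘(ℂ, E₁) (fun p : M₁ × M₁ ↦ p.1 + p.2) (f x, g x)
        (mfderiv 𝓘(ℂ, E) (𝓘(ℂ, E₁).prod 𝓘(ℂ, E₁)) (fun y ↦ (f y, g y)) x v) :=
    congrArg (fun L ↦ L v) h1
  have h3 (w : E₁ × E₁) :
      mfderiv (𝓘(ℂ, E₁).prod 𝓘(ℂ, E₁)) 𝓘(ℂ, E₁) (fun p : M₁ × M₁ ↦ p.1 + p.2) (f x, g x) w =
      modelDeriv E₁ E₁ (fun z : M₁ ↦ z + g x) (f x) w.1 +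
        modelDeriv E₁ E₁ (fun z : M₁ ↦ f x + z) (g x) w.2 :=
    mfderiv_prod_eq_add_apply hadd
  rw [h2, mfderiv_prodMk hf hg]
  refine (h3 _).trans ?_
  simp only [hf0, hg0, add_zero, zero_add, modelDeriv_id]
  rfl

end DerivativeAtZero

variable {E : Type*} [NormedAddCommGroup E] [NormedSpace ℂ E]
  {A : Type*} [AddCommGroup A] [TopologicalSpace A] [ChartedSpace E A]

/-! ### The group structure and tangent space of an abelian subvariety. -/

section Subvariety

variable {F : Type*} [NormedAddCommGroup F] [NormedSpace ℂ F]
  {B : AddSubgroup A} [ChartedSpace F B] [IsManifold 𝓘(ℂ, F) ω B]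

/-- Given continuity, holomorphy of a map into `B` can be tested after the immersion into `A`, where
the operations are those of `A`. -/
theorem IsAbelianSubvariety.lieAddGroup [LieAddGroup 𝓘(ℂ, E) ω A]
    (hB : IsAbelianSubvariety E F B) : LieAddGroup 𝓘(ℂ, F) ω B where
  contMDiff_add := by
    rw [ContMDiff.iff_comp_isImmersion hB.embedding.isImmersion]
    have hv := hB.embedding.isImmersion.contMDiff
    have hc : ContMDiff (𝓘(ℂ, F).prod 𝓘(ℂ, F)) 𝓘(ℂ, E) ω
        (fun p : B × B ↦ (p.1 : A) + p.2) :=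
      (hv.comp contMDiff_fst).add (hv.comp contMDiff_snd)
    exact ⟨hc.continuous.subtype_mk _, hc⟩
  contMDiff_neg := by
    rw [ContMDiff.iff_comp_isImmersion hB.embedding.isImmersion]
    have hc : ContMDiff 𝓘(ℂ, F) 𝓘(ℂ, E) ω (fun b : B ↦ -(b : A)) :=
      hB.embedding.isImmersion.contMDiff.neg
    exact ⟨hc.continuous.subtype_mk _, hc⟩

/-- In adapted charts the immersion is `u ↦ (u, 0)`; the inverse is projection to the first factor.
-/
theorem IsImmersionAt.exists_leftInverse {M M₁ E₁ : Type*}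
    [NormedAddCommGroup E₁] [NormedSpace ℂ E₁]
    [TopologicalSpace M] [ChartedSpace E M] [IsManifold 𝓘(ℂ, E) ω M]
    [TopologicalSpace M₁] [ChartedSpace E₁ M₁] [IsManifold 𝓘(ℂ, E₁) ω M₁]
    {f : M → M₁} {x : M}
    (h : Manifold.IsImmersionAt 𝓘(ℂ, E) 𝓘(ℂ, E₁) ω f x) :
    ∃ r : M₁ → M, ContMDiffAt 𝓘(ℂ, E₁) 𝓘(ℂ, E) ω r (f x) ∧ ∀ᶠ y in 𝓝 x, r (f y) = y := by
  have hw (y : M) (hy : y ∈ h.domChart.source) :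
      (h.equiv.symm (h.codChart (f y))).1 = h.domChart y := by
    have he : h.domChart y ∈ (h.domChart.extend 𝓘(ℂ, E)).target := by
      simpa using h.domChart.map_source hy
    have := h.writtenInCharts he
    simp only [OpenPartialHomeomorph.extend, Function.comp_apply] at this
    simp [h.domChart.left_inv hy] at this
    rw [this]
    simp
  have hx := h.mem_domChart_source
  refine ⟨fun z ↦ h.domChart.symm (h.equiv.symm (h.codChart z)).1, ?_, ?_⟩
  · have h1 : ContMDiffAt 𝓘(ℂ, E₁) 𝓘(ℂ, E₁) ω h.codChart (f x) :=
      contMDiffAt_of_mem_maximalAtlas h.codChart_mem_maximalAtlas h.mem_codChart_source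
    have h2 : ContDiff ℂ ω (fun e ↦ (h.equiv.symm e).1) := by fun_prop
    have h3 : ContMDiffAt 𝓘(ℂ, E) 𝓘(ℂ, E) ω h.domChart.symm
        (h.equiv.symm (h.codChart (f x))).1 := by
      rw [hw x hx]
      exact contMDiffAt_symm_of_mem_maximalAtlas h.domChart_mem_maximalAtlas
        (h.domChart.map_source hx)
    exact ContMDiffAt.comp (f x) h3 (h2.contMDiff.contMDiffAt.comp _ h1)
  · filter_upwards [h.domChart.open_source.mem_nhds hx] with y hy
    rw [hw y hy, h.domChart.left_inv hy]

theorem IsAbelianSubvariety.modelDeriv_val_injective [IsManifold 𝓘(ℂ, E) ω A]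
    (hB : IsAbelianSubvariety E F B) :
    Function.Injective (modelDeriv F E (Subtype.val : B → A) 0) := by
  obtain ⟨r, hr, hrv⟩ := IsImmersionAt.exists_leftInverse (hB.embedding.isImmersion.isImmersionAt 0)
  have hv := (hB.embedding.isImmersion.contMDiff (0 : B)).mdifferentiableAt (by simp)
  have h1 := modelDeriv_comp rfl (hr.mdifferentiableAt (by simp)) hv
  have h2 : modelDeriv F F (r ∘ (Subtype.val : B → A)) 0 = ContinuousLinearMap.id ℂ F := by
    rw [← modelDeriv_id (0 : B)]
    exact Filter.EventuallyEq.mfderiv_eq hrv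
  rw [h2] at h1
  exact Function.LeftInverse.injective (g := modelDeriv E F r (0 : B))
    fun v ↦ (congrArg (fun L ↦ L v) h1).symm

/-- A holomorphic map into `A` with values in `B` near a point lifts to `B` there. -/
theorem IsAbelianSubvariety.exists_lift {E₁ M : Type*} [NormedAddCommGroup E₁] [NormedSpace ℂ E₁]
    [TopologicalSpace M] [ChartedSpace E₁ M] [IsManifold 𝓘(ℂ, E) ω A] [IsManifold 𝓘(ℂ, E₁) ω M]
    (hB : IsAbelianSubvariety E F B) {p : M → A} {x : M}
    (hp : ContMDiffAt 𝓘(ℂ, E₁) 𝓘(ℂ, E) ω p x) (hpB : ∀ᶠ y in 𝓝 x, p y ∈ B) :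
    ∃ l : M → B, ContMDiffAt 𝓘(ℂ, E₁) 𝓘(ℂ, F) ω l x ∧ ∀ᶠ y in 𝓝 x, (l y : A) = p y := by
  classical
  -- The default value `0` is never taken near `x`, so it does not affect the germ of the lift.
  have hl : ∀ᶠ y in 𝓝 x, ((if h : p y ∈ B then ⟨p y, h⟩ else 0 : B) : A) = p y := by
    filter_upwards [hpB] with y hy
    rw [dif_pos hy]
  refine ⟨fun y ↦ if h : p y ∈ B then ⟨p y, h⟩ else 0, ?_, hl⟩
  rw [ContMDiffAt.iff_comp_isImmersionAt (hB.embedding.isImmersion.isImmersionAt _)]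
  have hc := hp.congr_of_eventuallyEq hl
  exact ⟨Topology.IsInducing.subtypeVal.continuousAt_iff.2 hc.continuousAt, hc⟩

end Subvariety

/-! ### Local sections, and the group structure and tangent space of the quotient. -/

section Quotient

variable {G : Type*} [NormedAddCommGroup G] [NormedSpace ℂ G]

/-- In adapted charts the submersion is a projection to the first factor; freezing the second
coordinate at that of `x` gives a section through `x`. -/
theorem IsSubmersionAt.exists_rightInverse {M M₁ E₁ : Type*}
    [NormedAddCommGroup E₁] [NormedSpace ℂ E₁]
    [TopologicalSpace M] [ChartedSpace E M] [IsManifold 𝓘(ℂ, E) ω M]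
    [TopologicalSpace M₁] [ChartedSpace E₁ M₁] [IsManifold 𝓘(ℂ, E₁) ω M₁]
    {f : M → M₁} {x : M}
    (h : Manifold.IsSubmersionAt 𝓘(ℂ, E) 𝓘(ℂ, E₁) ω f x) :
    ∃ s : M₁ → M, ContMDiffAt 𝓘(ℂ, E₁) 𝓘(ℂ, E) ω s (f x) ∧ s (f x) = x ∧
      ∀ᶠ z in 𝓝 (f x), f (s z) = z := by
  let u : M₁ → E := fun z ↦ h.equiv.symm (h.codChart z, (h.equiv (h.domChart x)).2)
  have hw : ∀ e ∈ h.domChart.target, h.codChart (f (h.domChart.symm e)) = (h.equiv e).1 := by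
    intro e he
    have he' : e ∈ (h.domChart.extend 𝓘(ℂ, E)).target := by simpa using he
    simpa using h.writtenInCharts he'
  have hx := h.mem_domChart_source
  have hux : u (f x) = h.domChart x := by
    have := hw _ (h.domChart.map_source hx)
    rw [h.domChart.left_inv hx] at this
    simp only [u, this, Prod.mk.eta, ContinuousLinearEquiv.symm_apply_apply]
  have hu : ContMDiffAt 𝓘(ℂ, E₁) 𝓘(ℂ, E) ω u (f x) := by
    have h1 : ContMDiffAt 𝓘(ℂ, E₁) 𝓘(ℂ, E₁) ω h.codChart (f x) :=
      contMDiffAt_of_mem_maximalAtlas h.codChart_mem_maximalAtlas h.mem_codChart_source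
    have h2 : ContDiff ℂ ω (fun g : E₁ ↦ h.equiv.symm (g, (h.equiv (h.domChart x)).2)) := by
      fun_prop
    exact h2.contMDiff.contMDiffAt.comp _ h1
  have htx : h.domChart x ∈ h.domChart.target := h.domChart.map_source hx
  refine ⟨fun z ↦ h.domChart.symm (u z), ?_, ?_, ?_⟩
  · have h1 : ContMDiffAt 𝓘(ℂ, E) 𝓘(ℂ, E) ω h.domChart.symm (u (f x)) := by
      rw [hux]
      exact contMDiffAt_symm_of_mem_maximalAtlas h.domChart_mem_maximalAtlas htx
    exact h1.comp _ hu
  · simp only [hux, h.domChart.left_inv hx]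
  · have e1 : ∀ᶠ z in 𝓝 (f x), u z ∈ h.domChart.target :=
      hu.continuousAt.eventually_mem (h.domChart.open_target.mem_nhds (hux ▸ htx))
    filter_upwards [e1, h.codChart.open_source.mem_nhds h.mem_codChart_source] with z hz1 hz2
    refine h.codChart.injOn (h.source_subset_preimage_source (h.domChart.map_target hz1)) hz2 ?_
    rw [hw _ hz1]
    simp [u]

variable {B : AddSubgroup A} [ChartedSpace G (A ⧸ B)] [IsManifold 𝓘(ℂ, G) ω (A ⧸ B)]

/-- Locally, the operations on `A ⧸ B` are those of `A` applied to holomorphic local sections,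
followed by the projection. -/
theorem IsQuotientVariety.lieAddGroup [LieAddGroup 𝓘(ℂ, E) ω A]
    (hQ : IsQuotientVariety E G B) : LieAddGroup 𝓘(ℂ, G) ω (A ⧸ B) where
  contMDiff_add := by
    rintro ⟨y, z⟩
    obtain ⟨a, rfl⟩ := QuotientAddGroup.mk_surjective y
    obtain ⟨b, rfl⟩ := QuotientAddGroup.mk_surjective z
    obtain ⟨s, hs, -, hsq⟩ := IsSubmersionAt.exists_rightInverse (hQ.submersion.isSubmersionAt a)
    obtain ⟨t, ht, -, htq⟩ := IsSubmersionAt.exists_rightInverse (hQ.submersion.isSubmersionAt b)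
    have h1 : ContMDiffAt (𝓘(ℂ, G).prod 𝓘(ℂ, G)) 𝓘(ℂ, E) ω
        (fun p : (A ⧸ B) × (A ⧸ B) ↦ s p.1 + t p.2) ((a : A ⧸ B), (b : A ⧸ B)) :=
      (ContMDiffAt.comp (g := s) ((a : A ⧸ B), (b : A ⧸ B)) hs contMDiffAt_fst).add
        (ContMDiffAt.comp (g := t) ((a : A ⧸ B), (b : A ⧸ B)) ht contMDiffAt_snd)
    refine (hQ.submersion.contMDiff.contMDiffAt.comp _ h1).congr_of_eventuallyEq ?_
    filter_upwards [continuousAt_fst.eventually hsq, continuousAt_snd.eventually htq] with p h1 h2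
    rw [Function.comp_apply, QuotientAddGroup.mk_add, h1, h2]
  contMDiff_neg := by
    intro y
    obtain ⟨a, rfl⟩ := QuotientAddGroup.mk_surjective y
    obtain ⟨s, hs, -, hsq⟩ := IsSubmersionAt.exists_rightInverse (hQ.submersion.isSubmersionAt a)
    refine (hQ.submersion.contMDiff.contMDiffAt.comp _ hs.neg).congr_of_eventuallyEq ?_
    filter_upwards [hsq] with p h1
    rw [Function.comp_apply, QuotientAddGroup.mk_neg, h1]

theorem IsQuotientVariety.modelDeriv_mk_surjective [IsManifold 𝓘(ℂ, E) ω A]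
    (hQ : IsQuotientVariety E G B) :
    Function.Surjective (modelDeriv E G (QuotientAddGroup.mk : A → A ⧸ B) 0) := by
  obtain ⟨s, hs, hs0, hsq⟩ := IsSubmersionAt.exists_rightInverse (hQ.submersion.isSubmersionAt 0)
  have h1 := modelDeriv_comp hs0 ((hQ.submersion.contMDiff (0 : A)).mdifferentiableAt (by simp))
    (hs.mdifferentiableAt (by simp))
  have h2 : modelDeriv G G ((QuotientAddGroup.mk : A → A ⧸ B) ∘ s) ((0 : A) : A ⧸ B) =
      ContinuousLinearMap.id ℂ G := by
    rw [← modelDeriv_id ((0 : A) : A ⧸ B)]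
    exact Filter.EventuallyEq.mfderiv_eq hsq
  rw [h2] at h1
  exact Function.RightInverse.surjective (g := modelDeriv G E s ((0 : A) : A ⧸ B))
    fun v ↦ (congrArg (fun L ↦ L v) h1).symm

end Quotient

/-! ### Exactness of the tangent sequence at the origin. -/

section Exactness

variable {F : Type*} [NormedAddCommGroup F] [NormedSpace ℂ F]
  {G : Type*} [NormedAddCommGroup G] [NormedSpace ℂ G]
  {B : AddSubgroup A} [ChartedSpace F B] [IsManifold 𝓘(ℂ, F) ω B]
  [ChartedSpace G (A ⧸ B)] [IsManifold 𝓘(ℂ, G) ω (A ⧸ B)]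

/-- The tangent spaces at `0` of `B`, `A` and `A ⧸ B` form an exact sequence. -/
theorem modelDeriv_exact [LieAddGroup 𝓘(ℂ, E) ω A] (hB : IsAbelianSubvariety E F B)
    (hQ : IsQuotientVariety E G B) :
    Function.Exact (modelDeriv F E (Subtype.val : B → A) 0)
      (modelDeriv E G (QuotientAddGroup.mk : A → A ⧸ B) 0) := by
  have hv := (hB.embedding.isImmersion.contMDiff (0 : B)).mdifferentiableAt (by simp)
  have hq := hQ.submersion.contMDiff (0 : A)
  have hq' := hq.mdifferentiableAt (by simp)
  intro v
  constructor
  · intro hqv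
    -- With a local section `s` through `0`, write `x = (x - s x̄) + s x̄`, where `x̄` is the class
    -- of `x`. The first term lies in `B` near `0`, and the differential of the second kills `v`
    -- because it factors through the projection. Hence `v` is the image of the differential of the
    -- lifted first term.
    obtain ⟨s, hs, hs0, hsq⟩ := IsSubmersionAt.exists_rightInverse (hQ.submersion.isSubmersionAt 0)
    have hsq' : ContMDiffAt 𝓘(ℂ, E) 𝓘(ℂ, E) ω (fun x : A ↦ s (x : A ⧸ B)) 0 := hs.comp 0 hq
    have hp : ContMDiffAt 𝓘(ℂ, E) 𝓘(ℂ, E) ω (fun x : A ↦ x - s (x : A ⧸ B)) 0 :=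
      contMDiffAt_id.sub hsq'
    have hpB : ∀ᶠ x : A in 𝓝 0, x - s (x : A ⧸ B) ∈ B := by
      filter_upwards [hq.continuousAt.eventually hsq] with x hx
      rw [← QuotientAddGroup.eq_zero_iff, QuotientAddGroup.mk_sub, hx, sub_self]
    obtain ⟨l, hl, hlp⟩ := hB.exists_lift hp hpB
    have hl0 : l 0 = 0 := by
      ext
      rw [hlp.self_of_nhds, hs0]
      simp
    have h1 := modelDeriv_comp hl0 hv (hl.mdifferentiableAt (by simp))
    have h2 : modelDeriv E E ((Subtype.val : B → A) ∘ l) 0 =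
        modelDeriv E E (fun x : A ↦ x - s (x : A ⧸ B)) 0 :=
      Filter.EventuallyEq.mfderiv_eq hlp
    have h3 : modelDeriv E E (fun x : A ↦ s (x : A ⧸ B)) 0 v = 0 := by
      have := modelDeriv_comp rfl (hs.mdifferentiableAt (by simp)) hq'
      have := congrArg (fun L ↦ L v) this
      refine this.trans ?_
      rw [ContinuousLinearMap.comp_apply, hqv, map_zero]
    have h4 := modelDeriv_add (hp.mdifferentiableAt (by simp)) (hsq'.mdifferentiableAt (by simp))
      (by rw [hs0, sub_self]) hs0
    simp only [sub_add_cancel, modelDeriv_id] at h4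
    refine ⟨modelDeriv E F l 0 v, ?_⟩
    have h5 := congrArg (fun L ↦ L v) h4
    have h6 := congrArg (fun L ↦ L v) (h1.symm.trans h2)
    simp only [add_apply, ContinuousLinearMap.id_apply, h3, add_zero] at h5
    exact h6.trans h5.symm
  · rintro ⟨w, rfl⟩
    have h1 := modelDeriv_comp (ZeroMemClass.coe_zero B) hq' hv
    have h2 : (QuotientAddGroup.mk : A → A ⧸ B) ∘ (Subtype.val : B → A) = fun _ ↦ 0 := by
      ext b
      exact (QuotientAddGroup.eq_zero_iff _).2 b.2
    rw [h2] at h1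
    refine (congrArg (fun L ↦ L w) h1).symm.trans ?_
    rw [modelDeriv, mfderiv_const]
    rfl

end Exactness

end ComplexAV

/-! ### Comparison of the eigenvalue multisets. -/

theorem lemma2p4 {E F G : Type*}
    [NormedAddCommGroup E] [NormedSpace ℂ E] [FiniteDimensional ℂ E]
    [NormedAddCommGroup F] [NormedSpace ℂ F] [FiniteDimensional ℂ F]
    [NormedAddCommGroup G] [NormedSpace ℂ G] [FiniteDimensional ℂ G]
    {A : Type*} [AddCommGroup A] [TopologicalSpace A] [ChartedSpace E A]
    [LieAddGroup 𝓘(ℂ, E) ω A] (_hA : ComplexAV.IsAbelianVariety E A)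
    (φ : A →+ A) (hφ : ComplexAV.IsIsogeny E φ)
    (B : AddSubgroup A) [ChartedSpace F B] [IsManifold 𝓘(ℂ, F) ω B]
    (hB : ComplexAV.IsAbelianSubvariety E F B)
    (hφB : B.map φ = B)
    [ChartedSpace G (A ⧸ B)] [IsManifold 𝓘(ℂ, G) ω (A ⧸ B)]
    (hQ : ComplexAV.IsQuotientVariety E G B) :
    ∃ (_ : FiniteDimensional ℂ (ComplexAV.H10 E A))
      (_ : FiniteDimensional ℂ (ComplexAV.H10 F B))
      (_ : FiniteDimensional ℂ (ComplexAV.H10 G (A ⧸ B))),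
      let Γ := ComplexAV.eigenvalues (ComplexAV.pullback φ hφ.holomorphic)
      let Δ := ComplexAV.eigenvalues (ComplexAV.pullback (ComplexAV.restrict φ B hφB)
        (hB.contMDiff_restrict hφ.holomorphic hφB))
      let Θ := ComplexAV.eigenvalues (ComplexAV.pullback (ComplexAV.descend φ B hφB)
        (hQ.contMDiff_descend hφ.holomorphic hφB))
      Γ.card = Module.finrank ℂ E ∧ Δ.card = Module.finrank ℂ F ∧ Δ ≤ Γ ∧ Θ = Γ - Δ := by
  have := _hA.compactSpace
  have := _hA.connectedSpace
  have : CompactSpace B := isCompact_iff_compactSpace.1 hB.isClosed.isCompact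
  have : ConnectedSpace B := isConnected_iff_connectedSpace.1 hB.isConnected
  have := hB.lieAddGroup
  have := hQ.lieAddGroup
  have : PreconnectedSpace (A ⧸ B) :=
    QuotientAddGroup.mk_surjective.denseRange.preconnectedSpace continuous_quot_mk
  have : CompactSpace (A ⧸ B) := Quotient.compactSpace
  have : FiniteDimensional ℂ (ComplexAV.H10 E A) := ComplexAV.finiteDimensional_H10
  have : FiniteDimensional ℂ (ComplexAV.H10 F B) := ComplexAV.finiteDimensional_H10
  have : FiniteDimensional ℂ (ComplexAV.H10 G (A ⧸ B)) := ComplexAV.finiteDimensional_H10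
  refine ⟨inferInstance, inferInstance, inferInstance, ?_⟩
  have hv := (hB.embedding.isImmersion.contMDiff (0 : B)).mdifferentiableAt (by simp)
  have hq := (hQ.submersion.contMDiff (0 : A)).mdifferentiableAt (by simp)
  have hφ' := (hφ.holomorphic 0).mdifferentiableAt (by simp)
  have hr := ((hB.contMDiff_restrict hφ.holomorphic hφB) 0).mdifferentiableAt (by simp)
  have hd := ((hQ.contMDiff_descend hφ.holomorphic hφB) 0).mdifferentiableAt (by simp)
  -- Each commuting square comes from the chain rule at `0` applied to one composite map factored in
  -- two ways.
  have hmul := LinearMap.charpoly_eq_mul_of_exact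
    (i := (ComplexAV.modelDeriv F E (Subtype.val : B → A) 0 : F →ₗ[ℂ] E))
    (q := (ComplexAV.modelDeriv E G (QuotientAddGroup.mk : A → A ⧸ B) 0 : E →ₗ[ℂ] G))
    hB.modelDeriv_val_injective hQ.modelDeriv_mk_surjective (ComplexAV.modelDeriv_exact hB hQ)
    (R := (ComplexAV.modelDeriv F F (ComplexAV.restrict φ B hφB) 0 : F →ₗ[ℂ] F))
    (S := (ComplexAV.modelDeriv E E φ 0 : E →ₗ[ℂ] E))
    (T := (ComplexAV.modelDeriv G G (ComplexAV.descend φ B hφB) 0 : G →ₗ[ℂ] G))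
    (congrArg ContinuousLinearMap.toLinearMap
      ((ComplexAV.modelDeriv_comp (ZeroMemClass.coe_zero B) hφ' hv).symm.trans
        (ComplexAV.modelDeriv_comp (g := (Subtype.val : B → A))
          (f := ComplexAV.restrict φ B hφB) (map_zero _) hv hr)))
    (congrArg ContinuousLinearMap.toLinearMap
      ((ComplexAV.modelDeriv_comp (map_zero φ) hq hφ').symm.trans
        (ComplexAV.modelDeriv_comp (g := ComplexAV.descend φ B hφB)
          (f := (QuotientAddGroup.mk : A → A ⧸ B)) (QuotientAddGroup.mk_zero B) hd hq)))
  dsimp only [ComplexAV.eigenvalues]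
  rw [ComplexAV.charpoly_pullback hφ.holomorphic (map_zero φ),
    ComplexAV.charpoly_pullback (hB.contMDiff_restrict hφ.holomorphic hφB) (map_zero _),
    ComplexAV.charpoly_pullback (hQ.contMDiff_descend hφ.holomorphic hφB) (map_zero _)]
  refine ⟨?_, ?_, ?_⟩
  · rw [IsAlgClosed.card_roots_eq_natDegree, LinearMap.charpoly_natDegree]
  · rw [IsAlgClosed.card_roots_eq_natDegree, LinearMap.charpoly_natDegree]
  · rw [hmul, Polynomial.roots_mul
      (mul_ne_zero (LinearMap.charpoly_monic _).ne_zero (LinearMap.charpoly_monic _).ne_zero)]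
    exact ⟨Multiset.le_add_right _ _, (add_tsub_cancel_left _ _).symm⟩
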